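/- Let $\omega=e^{2\pi i/3}$, $\theta=2\cos(2\pi/7)=\zeta_7+\zeta_7^{-1}$ with $\zeta_7=e^{2\pi i/7}$, $\mathbb K=\mathbb Q(\omega)$, $\mathbb L=\mathbb Q(\omega,\theta)\subset\mathbb C$, let $\mathcal O_{\mathbb L}$ be the ring of integers of $\mathbb L$, let $\sigma$ be the $\mathbb K$-automorphism of $\mathbb L$ with $\sigma(\zeta_7+\zeta_7^{-1})=\zeta_7^2+\zeta_7^{-2}$, and put $\gamma=\omega$, $\alpha=1+\omega+\theta$. For $x=(x_0,x_1,x_2)\in\mathcal O_{\mathbb L}^3$ let $$\mathbf X(x)=\begin{pmatrix}\alpha&&\\&\sigma(\alpha)&\\&&\sigma^2(\alpha)\end{pmatrix}\begin{pmatrix}x_0&x_1&x_2\\ \gamma\sigma(x_2)&\sigma(x_0)&\sigma(x_1)\\ \gamma\sigma^2(x_1)&\gamma\sigma^2(x_2)&\sigma^2(x_0)\end{pmatrix}$$ be the corresponding codeword of the $3\times3$ perfect space-time block code (up to a scaling factor, which does not affect what follows). Let $\mathfrak q_1,\dots,\mathfrak q_K$ be nonzero, pairwise relatively prime ideals of $\mathcal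 O_{\mathbb L}$, $\mathfrak q=\mathfrak q_1\cdots\mathfrak q_K$, and $q_k=|\mathcal O_{\mathbb L}/\mathfrak q_k|$. Let $e:\prod_k\mathcal O_{\mathbb L}/\mathfrak q_k\to\mathcal O_{\mathbb L}/\mathfrak q$ be a ring isomorphism, and let $\mathcal M$ be $e$ followed by the choice of a complete set of coset leaders of $\mathcal O_{\mathbb L}/\mathfrak q$ in $\mathcal O_{\mathbb L}$ (in particular, leaders of minimum energy are allowed). The $k$-th message is $w_k=(w_{k,0},w_{k,1},w_{k,2})\in(\mathcal O_{\mathbb L}/\mathfrak q_k)^3$, and the LSTIC encoder is $$\phi(w_1,\dots,w_K)=\mathbf X(x_0,x_1,x_2),\qquad x_\ell=\mathcal M(w_{1,\ell},\dots,w_{K,\ell}).$$ The rate of the $k$-th message, in bits per real symbol, is $R_k=\frac1{2\cdot3^2}\log_2(q_k^3)$, and $R_{\mathcal S}=\sum_{s\in\mathcal S}R_s$ for $\mathcal S\subseteq\{1,\dots,K\}$. Given messages $v=(v_1,\dots,v_K)$, the codebook $\mathcal C$ is the set of all $\phi(d)$, and the subcode $\mathcal C_{\mathcal S}$ is the set of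 all $\phi(d)$ with $d_s=v_s$ for $s\in\mathcal S$. Let $\Lambda_{\mathcal S}$ be the (translated) lattice from which $\mathcal C_{\mathcal S}$ is carved: the set of all $\mathbf X(x)$, $x\in\mathcal O_{\mathbb L}^3$, such that for all $\ell$ and all $s\in\mathcal S$ the $s$-th component of $e^{-1}(x_\ell\bmod\mathfrak q)$ is $v_{s,\ell}$; thus $\Lambda_\emptyset=\{\mathbf X(x):x\in\mathcal O_{\mathbb L}^3\}$ is the lattice from which $\mathcal C$ is carved. For a set $\mathcal D$ of $3\times 3$ matrices let $$\delta(\mathcal D)=\inf_{\mathbf X\ne\mathbf X'\in\mathcal D}\det\big((\mathbf X-\mathbf X')(\mathbf X-\mathbf X')^\dagger\big).$$ The minimum determinants of $\mathcal C$ and $\mathcal C_{\mathcal S}$ are, by the usual convention for codes carved from lattices, $\delta(\Lambda_\emptyset)$ and $\delta(\Lambda_{\mathcal S})$, and the normalized side information gain is $$\Gamma(\mathcal C,\mathcal S)=\frac{10\log_{10}\big(\delta(\Lambda_{\mathcal S})/\delta(\Lambda_\emptyset)\big)}{3R_{\mathcal S}} .$$ **Corollary (LSTIC based on the $3\times3$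 perfect STBC).** The encoder $\phi$ is injective, $\mathcal C\subseteq\Lambda_\emptyset$, and for every $\mathcal S\subseteq\{1,\dots,K\}$ such that $\mathfrak q_s\neq\mathcal O_{\mathbb L}$ for some $s\in\mathcal S$, and for all values $v$ of the side information: $\mathcal C_{\mathcal S}\subseteq\Lambda_{\mathcal S}$, $R_{\mathcal S}>0$, the infima $\delta(\Lambda_\emptyset)>0$ and $\delta(\Lambda_{\mathcal S})$ are attained, and $$\Gamma(\mathcal C,\mathcal S)=20\log_{10}2\approx 6\ \text{dB per bit per real symbol}.$$ In particular, if the finite codebooks satisfy $\delta(\mathcal C)=\delta(\Lambda_\emptyset)$ and $\delta(\mathcal C_{\mathcal S})=\delta(\Lambda_{\mathcal S})$, then $\dfrac{10\log_{10}(\delta(\mathcal C_{\mathcal S})/\delta(\mathcal C))}{3R_{\mathcal S}}=20\log_{10}2$ as well. -/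

import Mathlib

open scoped NumberField Matrix

namespace PerfectCode

/-- The primitive cube root of unity `ω = exp(2πi/3)`. -/
noncomputable def omega : ℂ := Complex.exp (2 * Real.pi * Complex.I / 3)

/-- The base field `K = ℚ(ω)`, as a subfield of `ℂ`. -/
noncomputable abbrev K : IntermediateField ℚ ℂ := IntermediateField.adjoin ℚ {omega}

/-- The real number `θ = ζ₇ + ζ₇⁻¹ = 2 cos(2π/7)`, seen in `ℂ`. -/
noncomputable def theta : ℂ := ((2 * Real.cos (2 * Real.pi / 7) : ℝ) : ℂ)

/-- The field `L = K(θ) = ℚ(ω, θ)`, as a subfield of `ℂ`. -/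
noncomputable abbrev L : IntermediateField K ℂ := IntermediateField.adjoin K {theta}

/-- `ω` as an element of `L`. -/
noncomputable def omegaL : L :=
  algebraMap K L ⟨omega, IntermediateField.mem_adjoin_simple_self ℚ omega⟩

/-- `θ` as an element of `L`. -/
noncomputable def thetaL : L := ⟨theta, IntermediateField.mem_adjoin_simple_self K theta⟩

/-- The primitive seventh root of unity `ζ₇ = exp(2πi/7)`. -/
noncomputable def zeta : ℂ := Complex.exp (2 * Real.pi * Complex.I / 7)

theorem zeta_primitive : IsPrimitiveRoot zeta 7 := by
  have := Complex.isPrimitiveRoot_exp 7 (by norm_num)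
  simpa [zeta] using this

theorem theta_eq : theta = zeta + zeta⁻¹ := by
  unfold theta zeta
  rw [← Complex.exp_neg]
  push_cast
  rw [Complex.two_cos]
  congr 2 <;> ring

theorem theta_root : theta ^ 3 + theta ^ 2 - 2 * theta - 1 = 0 := by
  have h0 : zeta ≠ 0 := zeta_primitive.ne_zero (by norm_num)
  have h := zeta_primitive.geom_sum_eq_zero (by norm_num)
  simp only [Finset.sum_range_succ, Finset.sum_range_zero] at h
  rw [theta_eq]
  field_simp
  linear_combination h

/-- The polynomial `X³ + X² - 2X - 1` over `ℤ`. -/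
noncomputable def cubic : Polynomial ℤ :=
  Polynomial.X ^ 3 + Polynomial.X ^ 2 - 2 * Polynomial.X - 1

theorem cubic_natDegree : cubic.natDegree = 3 := by unfold cubic; compute_degree!

theorem cubic_monic : cubic.Monic := by unfold cubic; monicity!

theorem cubic_irreducible_rat : Irreducible (cubic.map (algebraMap ℤ ℚ)) := by
  have hm := cubic_monic.map (algebraMap ℤ ℚ)
  have hd : (cubic.map (algebraMap ℤ ℚ)).natDegree = 3 := by
    rw [cubic_monic.natDegree_map, cubic_natDegree]
  rw [hm.irreducible_iff_roots_eq_zero_of_degree_le_three (by omega) (by omega)]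
  rw [Multiset.eq_zero_iff_forall_notMem]
  intro r hr
  have hr' : (Polynomial.aeval r) cubic = 0 := by
    have := (Polynomial.mem_roots'.1 hr).2
    rwa [Polynomial.IsRoot.def, Polynomial.eval_map_algebraMap] at this
  obtain ⟨z, rfl⟩ := isInteger_of_is_root_of_monic cubic_monic hr'
  have hz : z ^ 3 + z ^ 2 - 2 * z - 1 = 0 := by
    have h2 : ((z ^ 3 + z ^ 2 - 2 * z - 1 : ℤ) : ℚ) = 0 := by
      simp only [cubic, map_sub, map_add, map_pow, map_mul, Polynomial.aeval_X, map_one,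
        map_ofNat] at hr'
      simpa using hr'
    exact_mod_cast h2
  have hdvd : z ∣ 1 := ⟨z ^ 2 + z - 2, by linear_combination -hz⟩
  rcases Int.isUnit_iff.1 (isUnit_of_dvd_one hdvd) with h | h <;> subst h <;> norm_num at hz

theorem omega_integral : IsIntegral ℚ omega := by
  refine ⟨Polynomial.X ^ 3 - 1, by monicity!, ?_⟩
  have : omega ^ 3 = 1 := by
    have := (Complex.isPrimitiveRoot_exp 3 (by norm_num)).pow_eq_one
    simpa [omega] using this
  simp [this]

theorem K_finrank_le : Module.finrank ℚ K ≤ 2 := by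
  rw [IntermediateField.adjoin.finrank omega_integral]
  have hp : IsPrimitiveRoot omega 3 := by
    simpa [omega] using Complex.isPrimitiveRoot_exp 3 (by norm_num)
  have h := hp.geom_sum_eq_zero (by norm_num)
  simp only [Finset.sum_range_succ, Finset.sum_range_zero] at h
  have hd : (Polynomial.X ^ 2 + Polynomial.X + 1 : Polynomial ℚ).natDegree = 2 := by
    compute_degree!
  rw [← hd]
  apply Polynomial.natDegree_le_of_dvd
  · apply minpoly.dvd
    simp only [map_add, map_pow, Polynomial.aeval_X, map_one]
    linear_combination h
  · intro h0
    rw [h0] at hd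
    simp at hd

theorem cubic_irreducible : Irreducible (cubic.map (algebraMap ℤ K)) := by
  have hm := cubic_monic.map (algebraMap ℤ K)
  have hd : (cubic.map (algebraMap ℤ K)).natDegree = 3 := by
    rw [cubic_monic.natDegree_map, cubic_natDegree]
  rw [hm.irreducible_iff_roots_eq_zero_of_degree_le_three (by omega) (by omega)]
  rw [Multiset.eq_zero_iff_forall_notMem]
  intro r hr
  have hr' : (Polynomial.aeval r) (cubic.map (algebraMap ℤ ℚ)) = 0 := by
    have := (Polynomial.mem_roots'.1 hr).2
    rw [Polynomial.IsRoot.def, Polynomial.eval_map_algebraMap] at this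
    rwa [Polynomial.aeval_map_algebraMap]
  have hmin := minpoly.eq_of_irreducible_of_monic cubic_irreducible_rat hr'
    (cubic_monic.map (algebraMap ℤ ℚ))
  have : FiniteDimensional ℚ K := IntermediateField.adjoin.finiteDimensional omega_integral
  have h3 : (minpoly ℚ r).natDegree ≤ Module.finrank ℚ K := minpoly.natDegree_le r
  rw [← hmin, cubic_monic.natDegree_map, cubic_natDegree] at h3
  have := K_finrank_le
  omega

theorem theta_minpoly : minpoly K theta = cubic.map (algebraMap ℤ K) := by
  refine (minpoly.eq_of_irreducible_of_monic cubic_irreducible ?_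
    (cubic_monic.map (algebraMap ℤ K))).symm
  rw [Polynomial.aeval_map_algebraMap]
  simp only [cubic, map_sub, map_add, map_pow, map_mul, Polynomial.aeval_X, map_one, map_ofNat]
  exact theta_root

theorem theta_integral : IsIntegral K theta := by
  refine ⟨cubic.map (algebraMap ℤ K), cubic_monic.map _, ?_⟩
  rw [← theta_minpoly]
  exact minpoly.aeval K theta

/-- There is a `K`-automorphism of `L` taking `θ = ζ₇ + ζ₇⁻¹` to `ζ₇² + ζ₇⁻²`. -/
theorem exists_sigma : ∃ s : L ≃ₐ[K] L, ((s thetaL : L) : ℂ) = zeta ^ 2 + (zeta ^ 2)⁻¹ := by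
  have : FiniteDimensional K L := IntermediateField.adjoin.finiteDimensional theta_integral
  have hroot : thetaL ^ 3 + thetaL ^ 2 - 2 * thetaL - 1 = 0 := by
    apply Subtype.ext
    exact theta_root
  have h0 : Polynomial.aeval (thetaL ^ 2 - 2)
      (minpoly K (IntermediateField.adjoin.powerBasis theta_integral).gen) = 0 := by
    rw [IntermediateField.adjoin.powerBasis_gen, IntermediateField.minpoly_gen, theta_minpoly,
      Polynomial.aeval_map_algebraMap]
    simp only [cubic, map_sub, map_add, map_pow, map_mul, Polynomial.aeval_X, map_one, map_ofNat]
    linear_combination (thetaL ^ 3 - thetaL ^ 2 - 2 * thetaL + 1) * hroot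
  let f : L →ₐ[K] L := (IntermediateField.adjoin.powerBasis theta_integral).lift _ h0
  have hf : f thetaL = thetaL ^ 2 - 2 := by
    have := (IntermediateField.adjoin.powerBasis theta_integral).lift_gen _ h0
    rwa [IntermediateField.adjoin.powerBasis_gen] at this
  refine ⟨AlgEquiv.ofBijective f (Algebra.IsAlgebraic.algHom_bijective f), ?_⟩
  have hz : zeta ≠ 0 := zeta_primitive.ne_zero (by norm_num)
  rw [AlgEquiv.ofBijective_apply, hf]
  have : ((thetaL ^ 2 - 2 : L) : ℂ) = theta ^ 2 - 2 := by
    rfl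
  rw [this, theta_eq]
  field_simp
  ring

/-- The generator `σ` of `Gal(L/K)`: the `K`-automorphism with `σ(ζ₇ + ζ₇⁻¹) = ζ₇² + ζ₇⁻²`
(it is the only one, since `L = K(θ)`). -/
noncomputable def sigma : L ≃ₐ[K] L := exists_sigma.choose

theorem sigma_theta : ((sigma thetaL : L) : ℂ) = zeta ^ 2 + (zeta ^ 2)⁻¹ :=
  exists_sigma.choose_spec

/-- `α = 1 + ω + θ`. -/
noncomputable def alpha : L := 1 + omegaL + thetaL

/-- The matrix of `x₀ + x₁e + x₂e²` in the cyclic algebra `(L/K, σ, γ)` with `γ = ω`. -/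
noncomputable def layerMatrix (x : Fin 3 → L) : Matrix (Fin 3) (Fin 3) ℂ :=
  !![(x 0 : ℂ),                        x 1,                                x 2;
     omega * sigma (x 2),              sigma (x 0),                        sigma (x 1);
     omega * sigma (sigma (x 1)),      omega * sigma (sigma (x 2)),        sigma (sigma (x 0))]

/-- The codeword `D(α) · (matrix of x)`, with `D(α) = diag(α, σ(α), σ²(α))`. -/
noncomputable def codeword (x : Fin 3 → 𝓞 L) : Matrix (Fin 3) (Fin 3) ℂ :=
  Matrix.diagonal ![(alpha : ℂ), sigma alpha, sigma (sigma alpha)] *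
    layerMatrix fun l => (x l : L)

section Scheme

variable {k : ℕ} (q : Fin k → Ideal (𝓞 L))

/-- Messages: the `i`-th message has three sub-messages (one per layer) in `𝓞 L / q i`. -/
abbrev Message (i : Fin k) : Type := Fin 3 → 𝓞 L ⧸ q i

/-- The encoder: layer `l` carries the coset leader `lead (e (w₁ₗ, …, w_kₗ))`. -/
noncomputable def encode (e : (∀ i, 𝓞 L ⧸ q i) ≃+* 𝓞 L ⧸ ∏ i, q i)
    (lead : 𝓞 L ⧸ ∏ i, q i → 𝓞 L) (w : ∀ i, Message q i) : Matrix (Fin 3) (Fin 3) ℂ :=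
  codeword fun l => lead (e fun i => w i l)

/-- The finite subcode `C_S`: all codewords whose messages with index in `S` are those of `v`. For
`S = ∅` it is the whole codebook `C`. -/
def subcode (e : (∀ i, 𝓞 L ⧸ q i) ≃+* 𝓞 L ⧸ ∏ i, q i) (lead : 𝓞 L ⧸ ∏ i, q i → 𝓞 L)
    (S : Finset (Fin k)) (v : ∀ i, Message q i) : Set (Matrix (Fin 3) (Fin 3) ℂ) :=
  {X | ∃ d : ∀ i, Message q i, (∀ i ∈ S, d i = v i) ∧ X = encode q e lead d}

/-- The (translated) lattice from which `C_S` is carved: all the matrices obtained from arbitrary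
layer signals in `𝓞 L` (not only coset leaders) whose messages with index in `S` are those of `v`.
For `S = ∅` it is the whole lattice of matrices `codeword x`. -/
def latticeSubcode (e : (∀ i, 𝓞 L ⧸ q i) ≃+* 𝓞 L ⧸ ∏ i, q i)
    (S : Finset (Fin k)) (v : ∀ i, Message q i) : Set (Matrix (Fin 3) (Fin 3) ℂ) :=
  {X | ∃ x : Fin 3 → 𝓞 L,
    (∀ i ∈ S, ∀ l, e.symm (Ideal.Quotient.mk (∏ i, q i) (x l)) i = v i l) ∧ X = codeword x}

/-- The rate `R_S = ∑_{i ∈ S} R_i` with `R_i = log₂(M_i) / r`, where `M_i` is the number of values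
of the `i`-th message and `r = 2 · 3²` the number of real symbols per codeword. -/
noncomputable def rate (S : Finset (Fin k)) : ℝ :=
  ∑ i ∈ S, Real.logb 2 (Nat.card (Message q i)) / (2 * 3 ^ 2)

end Scheme

/-- The values `det((X - X')(X - X')†)` for `X ≠ X'` in a code. -/
def pairDets (C : Set (Matrix (Fin 3) (Fin 3) ℂ)) : Set ℝ :=
  {d | ∃ X ∈ C, ∃ X' ∈ C, X ≠ X' ∧ (d : ℂ) = ((X - X') * (X - X')ᴴ).det}

/-- The minimum determinant `δ(C)`. -/
noncomputable def minDet (C : Set (Matrix (Fin 3) (Fin 3) ℂ)) : ℝ := sInf (pairDets C)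

/-- The normalized side information gain `10 log₁₀(δ(C_S) / δ(C)) / (n_t R_S)` with `n_t = 3`. -/
noncomputable def gain (C CS : Set (Matrix (Fin 3) (Fin 3) ℂ)) (R : ℝ) : ℝ :=
  10 * Real.logb 10 (minDet CS / minDet C) / (3 * R)

end PerfectCode

/-!
A difference of two codewords is `D(α)` times the matrix of an element of the cyclic algebra
`(L/K, σ, ω)`, so its determinant is `N(α)` times a reduced norm. Since `|N(α)|² = 7` is the ideal
norm of `α`, everything reduces to the least value of `|·|²` at the reduced norms of nonzero `x`
with coordinates in an ideal `I`. This least value is the ideal norm of `I`, because `𝓞 L` is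
principal: if `I = (b)` and `x = b • y`, then the reduced norm of `x` is `N(b)` times that of `y`,
which is a nonzero element of `𝓞 K` and hence has absolute value at least `1`.

The algebra is a division algebra because `α` generates a `σ`-stable prime with residue field `𝔽₇`,
on which `σ` acts trivially and where the form `a³ + 4b³ + 16c³ - 12abc` is anisotropic: a zero of
the reduced norm would be divisible by every power of `α`.

The ring `𝓞 L` is principal because the Minkowski bound is less than `9`. A residue field with
`q < 9` elements contains roots of `X² + X + 1` and `X³ + X² - 2X - 1`, so that `q ≢ 2 mod 3` and
`q ≡ 0, ±1 mod 7`, which leaves `q = 7`. A homomorphism to `𝔽₇` sends `θ` to `2` and `ω` to `2` or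
`4`; accordingly its kernel is generated by `θ - ω` or by `α`, both of norm `7`.

Finally, the subcode with side information `S` is carved from a coset of an ideal of norm
`N = ∏ q_s`, so the minimum determinant grows by the factor `N` while `R_S = log₂ N / 6`.
-/

namespace PerfectCode

section CyclicAlgebra

variable {R : Type*} [CommRing R]

/-- The norm form `b ↦ b τ(b) τ²(b)` of a ring endomorphism `τ`, thought of as having order
three. -/
def cyclicNorm (τ : R →+* R) (b : R) : R := b * τ b * τ (τ b)

/-- The matrix of `x₀ + x₁e + x₂e²` in the cyclic algebra `(R, τ, γ)` generated over `R` by an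
element `e` with `e b = τ(b) e` and `e³ = γ`. -/
def cyclicMatrix (τ : R →+* R) (γ : R) (x : Fin 3 → R) : Matrix (Fin 3) (Fin 3) R :=
  !![x 0,             x 1,             x 2;
     γ * τ (x 2),     τ (x 0),         τ (x 1);
     γ * τ (τ (x 1)), γ * τ (τ (x 2)), τ (τ (x 0))]

/-- The reduced norm of `x₀ + x₁e + x₂e²` in the cyclic algebra `(R, τ, γ)`. -/
def reducedNorm (τ : R →+* R) (γ : R) (x : Fin 3 → R) : R := (cyclicMatrix τ γ x).det

variable (τ : R →+* R) (γ : R)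

theorem reducedNorm_eq (x : Fin 3 → R) :
    reducedNorm τ γ x = cyclicNorm τ (x 0) + γ * cyclicNorm τ (x 1) + γ ^ 2 * cyclicNorm τ (x 2)
      - γ * (x 0 * τ (x 1) * τ (τ (x 2)) + x 1 * τ (x 2) * τ (τ (x 0))
        + x 2 * τ (x 0) * τ (τ (x 1))) := by
  rw [reducedNorm, cyclicMatrix, Matrix.det_fin_three]
  simp only [cyclicNorm, Matrix.of_apply, Matrix.cons_val]
  ring

theorem reducedNorm_single_zero (b : R) : reducedNorm τ γ (Pi.single 0 b) = cyclicNorm τ b := by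
  simp [reducedNorm_eq, cyclicNorm]

theorem cyclicMatrix_sub (x y : Fin 3 → R) :
    cyclicMatrix τ γ (x - y) = cyclicMatrix τ γ x - cyclicMatrix τ γ y := by
  ext i j
  fin_cases i <;> fin_cases j <;> simp [cyclicMatrix, mul_sub]

theorem cyclicMatrix_smul (b : R) (x : Fin 3 → R) :
    cyclicMatrix τ γ (b • x) = Matrix.diagonal ![b, τ b, τ (τ b)] * cyclicMatrix τ γ x := by
  ext i j
  fin_cases i <;> fin_cases j <;> simp [cyclicMatrix, mul_left_comm]

theorem reducedNorm_smul (b : R) (x : Fin 3 → R) :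
    reducedNorm τ γ (b • x) = cyclicNorm τ b * reducedNorm τ γ x := by
  rw [reducedNorm, cyclicMatrix_smul, Matrix.det_mul, Matrix.det_diagonal, Fin.prod_univ_three]
  rfl

variable {τ γ}

theorem map_reducedNorm {R' : Type*} [CommRing R'] {τ' : R' →+* R'} {f : R →+* R'}
    (hf : ∀ b, f (τ b) = τ' (f b)) (x : Fin 3 → R) :
    f (reducedNorm τ γ x) = reducedNorm τ' (f γ) (f ∘ x) := by
  simp only [reducedNorm_eq, cyclicNorm, map_sub, map_add, map_mul, map_pow, hf,
    Function.comp_apply]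

theorem reducedNorm_fixed (hτ : ∀ b, τ (τ (τ b)) = b) (hγ : τ γ = γ) (x : Fin 3 → R) :
    τ (reducedNorm τ γ x) = reducedNorm τ γ x := by
  simp only [reducedNorm_eq, cyclicNorm, map_sub, map_add, map_mul, map_pow, hτ, hγ]
  ring

theorem dvd_of_reducedNorm_eq_zero {F : Type*} [CommRing F] {f : R →+* F} {π : R}
    (hπ : RingHom.ker f = Ideal.span {π}) (hf : ∀ b, f (τ b) = f b)
    (hF : ∀ y, reducedNorm (RingHom.id F) (f γ) y = 0 → y = 0)
    {x : Fin 3 → R} (hx : reducedNorm τ γ x = 0) (l : Fin 3) : π ∣ x l := by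
  have h : reducedNorm (RingHom.id F) (f γ) (f ∘ x) = 0 := by
    rw [← map_reducedNorm hf, hx, map_zero]
  rw [← Ideal.mem_span_singleton, ← hπ, RingHom.mem_ker]
  exact congrFun (hF _ h) l

section Descent

variable [IsDomain R] {π : R} (hτ : Function.Injective τ) (hπ0 : π ≠ 0)
  (hdvd : ∀ x, reducedNorm τ γ x = 0 → ∀ l, π ∣ x l)
include hτ hπ0 hdvd

theorem pow_dvd_of_reducedNorm_eq_zero (n : ℕ) {x : Fin 3 → R} (hx : reducedNorm τ γ x = 0)
    (l : Fin 3) : π ^ n ∣ x l := by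
  induction n generalizing x with
  | zero => simp
  | succ n ih =>
    choose y hy using hdvd x hx
    have hπ : cyclicNorm τ π ≠ 0 := by
      simp only [cyclicNorm, ne_eq, mul_eq_zero, map_eq_zero_iff τ hτ, hπ0, or_self,
        not_false_eq_true]
    rw [show x = π • y from funext hy, reducedNorm_smul] at hx
    rw [hy l, pow_succ']
    exact mul_dvd_mul_left π (ih ((mul_eq_zero.1 hx).resolve_left hπ))

theorem reducedNorm_ne_zero [WfDvdMonoid R] (hπu : ¬ IsUnit π) {x : Fin 3 → R} (hx : x ≠ 0) :
    reducedNorm τ γ x ≠ 0 := by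
  intro h
  obtain ⟨l, hl⟩ := Function.ne_iff.1 hx
  obtain ⟨n, hn⟩ := FiniteMultiplicity.of_not_isUnit hπu hl
  exact hn (pow_dvd_of_reducedNorm_eq_zero hτ hπ0 hdvd _ h l)

end Descent

end CyclicAlgebra

section Galois

open Module

variable {E F : Type*} [Field E] [Field F] [Algebra E F] [FiniteDimensional E F]

theorem algebraMap_norm_eq_prod_range_pow {τ : F ≃ₐ[E] F} (hτ : orderOf τ = finrank E F) (x : F) :
    algebraMap E F (Algebra.norm E x) = ∏ i ∈ Finset.range (finrank E F), (τ ^ i) x := by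
  classical
  have hcard : Nat.card Gal(F/E) = finrank E F := by
    refine le_antisymm ?_ (hτ ▸ orderOf_le_card)
    rw [Nat.card_eq_fintype_card]
    exact AlgEquiv.card_le
  have : IsGalois E F := IsGalois.of_card_aut_eq_finrank E F hcard
  have hgen : Subgroup.zpowers τ = ⊤ :=
    Subgroup.eq_top_of_card_eq _ (by rw [Nat.card_zpowers, hτ, hcard])
  rw [Algebra.norm_eq_prod_automorphisms, ← hτ,
    ← IsCyclic.image_range_orderOf fun ρ => hgen ▸ Subgroup.mem_top ρ,
    Finset.prod_image fun i hi j hj =>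
      pow_injOn_Iio_orderOf (by simpa using hi) (by simpa using hj)]

theorem trace_algebraMap_mul {k : Type*} [Field k] [Algebra k E] [Algebra k F]
    [IsScalarTower k E F] [FiniteDimensional k E] (c : E) {y : F} {r : k}
    (hy : Algebra.trace E F y = algebraMap k E r) :
    Algebra.trace k F (algebraMap E F c * y) = Algebra.trace k E c * r := by
  rw [← Algebra.trace_trace (S := E), ← Algebra.smul_def, map_smul, hy, smul_eq_mul, mul_comm,
    ← Algebra.smul_def, map_smul, smul_eq_mul, mul_comm]

end Galois

section ComplexQuadratic

open Classical in
theorem norm_eq_mul_of_finrank_eq_two {F E : Type*} [Field F] [Field E] [Algebra F E] {Ω : Type*}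
    [Field Ω] [Algebra F Ω] [IsAlgClosed Ω] [Algebra.IsSeparable F E]
    (hE : Module.finrank F E = 2) {f g : E →ₐ[F] Ω} (hfg : f ≠ g) (z : E) :
    algebraMap F Ω (Algebra.norm F z) = f z * g z := by
  have : FiniteDimensional F E := Module.finite_of_finrank_eq_succ hE
  have huniv : {f, g} = (Finset.univ : Finset (E →ₐ[F] Ω)) := by
    rw [← Finset.card_eq_iff_eq_univ, AlgHom.card, hE, Finset.card_pair hfg]
  rw [Algebra.norm_eq_prod_embeddings F Ω, ← huniv, Finset.prod_pair hfg]

theorem norm_eq_normSq {F : IntermediateField ℚ ℂ} (hF : Module.finrank ℚ F = 2) {w : ℂ}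
    (hwF : w ∈ F) (hw : (starRingEnd ℂ) w ≠ w) (z : F) :
    (Algebra.norm ℚ z : ℝ) = Complex.normSq z := by
  have : FiniteDimensional ℚ F := Module.finite_of_finrank_eq_succ hF
  let conjVal : F →ₐ[ℚ] ℂ := (Complex.conjAe.restrictScalars ℚ).toAlgHom.comp F.val
  have hne : F.val ≠ conjVal := fun h => hw (DFunLike.congr_fun h ⟨w, hwF⟩).symm
  have h : ((Algebra.norm ℚ z : ℚ) : ℂ) = z * (starRingEnd ℂ) (z : ℂ) :=
    norm_eq_mul_of_finrank_eq_two hF hne z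
  rw [Complex.mul_conj] at h
  exact_mod_cast h

theorem norm_eq_normSq_norm {F : IntermediateField ℚ ℂ} (hF : Module.finrank ℚ F = 2) {w : ℂ}
    (hwF : w ∈ F) (hw : (starRingEnd ℂ) w ≠ w) {E : IntermediateField F ℂ} (x : E) :
    (Algebra.norm ℚ x : ℝ) = Complex.normSq (Algebra.norm F x : F) := by
  rw [← norm_eq_normSq hF hwF hw, Algebra.norm_norm]

theorem det_mul_conjTranspose_self {n : Type*} [Fintype n] [DecidableEq n] (M : Matrix n n ℂ) :
    (M * Mᴴ).det = (Complex.normSq M.det : ℂ) := by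
  rw [Matrix.det_mul, Matrix.det_conjTranspose, ← starRingEnd_apply, Complex.mul_conj]

end ComplexQuadratic

theorem discr_dvd_algebraDiscr {F : Type*} [Field F] [NumberField F] {ι : Type*} [Fintype ι]
    [DecidableEq ι] (hι : Fintype.card ι = Module.finrank ℚ F) (v : ι → 𝓞 F) :
    NumberField.discr F ∣ Algebra.discr ℤ v := by
  have hcard : Fintype.card (Module.Free.ChooseBasisIndex ℤ (𝓞 F)) = Fintype.card ι := by
    rw [← Module.finrank_eq_card_chooseBasisIndex, NumberField.RingOfIntegers.rank, hι]
  let b := (NumberField.RingOfIntegers.basis F).reindex (Fintype.equivOfCardEq hcard)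
  have hv : (b : ι → 𝓞 F) ᵥ* (b.toMatrix v).map (algebraMap ℤ (𝓞 F)) = v := by
    ext1 i
    rw [← b.sum_toMatrix_smul_self v i]
    simp only [Matrix.vecMul, dotProduct, Matrix.map_apply, Algebra.smul_def, mul_comm]
  rw [← hv, Algebra.discr_of_matrix_vecMul, NumberField.discr_eq_discr]
  exact dvd_mul_left _ _

theorem exists_ringHom_zmod_ker_eq {R : Type*} [CommRing R] {I : Ideal R} {p : ℕ} (hp : p.Prime)
    (h : Nat.card (R ⧸ I) = p) : ∃ f : R →+* ZMod p, RingHom.ker f = I := by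
  have : Finite (R ⧸ I) := Nat.finite_of_card_ne_zero (h ▸ hp.ne_zero)
  have := Fintype.ofFinite (R ⧸ I)
  let e := ZMod.ringEquivOfPrime (R ⧸ I) hp (Nat.card_eq_fintype_card.symm.trans h)
  refine ⟨(e.symm : R ⧸ I →+* ZMod p).comp (Ideal.Quotient.mk I), ?_⟩
  rw [RingHom.ker_comp_of_injective _ e.symm.injective, Ideal.mk_ker]

theorem ringHom_zmod_eq_of_ker_le {R : Type*} [CommRing R] {p : ℕ} [Fact p.Prime]
    {f g : R →+* ZMod p} (h : RingHom.ker f ≤ RingHom.ker g) : f = g :=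
  ZMod.ringHom_eq_of_ker_eq f g <|
    (RingHom.ker_isMaximal_of_surjective f (ZMod.ringHom_surjective f)).eq_of_le
      (RingHom.ker_ne_top g) h

theorem eq_span_singleton_of_mem {R : Type*} [CommRing R] [IsDedekindDomain R] [Module.Free ℤ R]
    {P : Ideal R} (hP : P ≠ ⊤) {a : R} (ha : a ∈ P)
    (hp : (Ideal.absNorm (Ideal.span {a})).Prime) : P = Ideal.span {a} := by
  have hprime : (Ideal.span {a}).IsPrime := Ideal.isPrime_of_irreducible_absNorm hp
  have hbot : Ideal.span {a} ≠ ⊥ := fun h => by simp [h, Nat.not_prime_zero] at hp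
  exact ((hprime.isMaximal hbot).eq_of_le hP ((Ideal.span_singleton_le_iff_mem P).2 ha)).symm

section FiniteField

variable {F : Type*} [Field F] [Fintype F]

theorem card_mod_three_ne_two {w : F} (hw : w ^ 2 + w + 1 = 0) : Fintype.card F % 3 ≠ 2 := by
  intro hq
  have hw3 : w ^ 3 = 1 := by linear_combination (w - 1) * hw
  have hfrob : w ^ 2 = w := by
    conv_rhs => rw [← FiniteField.pow_card w, ← Nat.div_add_mod (Fintype.card F) 3, hq, pow_add,
      pow_mul, hw3, one_pow, one_mul]
  have h1 : 2 * w + 1 = 0 := by linear_combination hw - hfrob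
  have h3 : (3 : F) = 0 := by linear_combination 4 * hw - (2 * w + 1) * h1
  have h2 : (2 : F) = 0 := by
    have h := FiniteField.cast_card_eq_zero F
    rw [← Nat.div_add_mod (Fintype.card F) 3, hq] at h
    push_cast at h
    linear_combination h - (Fintype.card F / 3 : ℕ) * h3
  exact one_ne_zero (α := F) (by linear_combination h3 - h2)

theorem dvd_card_of_cast_eq_zero {p : ℕ} (hp : p.Prime) (h : (p : F) = 0) :
    p ∣ Fintype.card F := by
  have : Fact p.Prime := ⟨hp⟩
  have : CharP F p := (CharP.charP_iff_prime_eq_zero hp).2 h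
  exact (CharP.cast_eq_zero_iff F p _).1 (FiniteField.cast_card_eq_zero F)

theorem card_mod_seven_of_root {A : Type*} [Field A] [Algebra F A] {t : F}
    (ht : t ^ 3 + t ^ 2 - 2 * t - 1 = 0) {z : A} (hz : z ^ 2 - algebraMap F A t * z + 1 = 0) :
    7 ∣ Fintype.card F ∨ Fintype.card F ≡ 1 [MOD 7] ∨ 7 ∣ Fintype.card F + 1 := by
  have hs : algebraMap F A t ^ 3 + algebraMap F A t ^ 2 - 2 * algebraMap F A t - 1 = 0 := by
    simpa only [map_sub, map_add, map_mul, map_pow, map_one, map_ofNat, map_zero] using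
      congrArg (algebraMap F A) ht
  have hz7 : z ^ 7 = 1 := by
    have hsz : algebraMap F A t * z = z ^ 2 + 1 := by linear_combination -hz
    linear_combination (z - 1) * (z ^ 3 * hs - ((algebraMap F A t * z) ^ 2
      + algebraMap F A t * z * (z ^ 2 + 1) + (z ^ 2 + 1) ^ 2
      + z * (algebraMap F A t * z + z ^ 2 + 1) - 2 * z ^ 2) * hsz)
  obtain rfl | hz1 := eq_or_ne z 1
  · have hst : t = 2 := (algebraMap F A).injective <| by
      rw [map_ofNat]
      linear_combination -hz
    rw [hst] at ht
    exact .inl (dvd_card_of_cast_eq_zero (by norm_num) (by push_cast; linear_combination ht))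
  have : Fact (Nat.Prime 7) := ⟨by norm_num⟩
  have hord : orderOf z = 7 := orderOf_eq_prime hz7 hz1
  have hfrob : (z ^ Fintype.card F) ^ 2 - algebraMap F A t * z ^ Fintype.card F + 1 = 0 := by
    simpa only [map_sub, map_add, map_mul, map_pow, map_one, map_zero, AlgHom.commutes,
      FiniteField.coe_frobeniusAlgHom] using congrArg (FiniteField.frobeniusAlgHom F A) hz
  have hconj : (z ^ Fintype.card F - z) * (z ^ (Fintype.card F + 1) - 1) = 0 := by
    rw [pow_succ]
    linear_combination z * hfrob - z ^ Fintype.card F * hz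
  rw [← hord]
  rcases mul_eq_zero.1 hconj with h | h
  · refine .inr (.inl ?_)
    rw [← (isOfFinOrder_iff_pow_eq_one.2 ⟨7, by norm_num, hz7⟩).pow_eq_pow_iff_modEq, pow_one]
    exact sub_eq_zero.1 h
  · exact .inr (.inr (orderOf_dvd_of_pow_eq_one (sub_eq_zero.1 h)))

/-- Writing `t = z + z⁻¹` makes `z` a seventh root of unity, and Frobenius, which fixes `t`, maps
`z` to `z` or to `z⁻¹`. -/
theorem card_mod_seven {t : F} (ht : t ^ 3 + t ^ 2 - 2 * t - 1 = 0) :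
    7 ∣ Fintype.card F ∨ Fintype.card F ≡ 1 [MOD 7] ∨ 7 ∣ Fintype.card F + 1 := by
  have hdeg (s : AlgebraicClosure F) :
      (Polynomial.X ^ 2 - Polynomial.C s * Polynomial.X + 1).degree = 2 := by
    compute_degree!
  obtain ⟨z, hz⟩ := IsAlgClosed.exists_root _
    (ne_of_eq_of_ne (hdeg (algebraMap F _ t)) two_ne_zero)
  exact card_mod_seven_of_root ht (z := z) (by simpa using hz)

end FiniteField

section Messages

variable {R ι : Type*} [CommRing R] {q : ι → Ideal R} {J : Ideal R}
  (e : (∀ i, R ⧸ q i) ≃+* R ⧸ J)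

/-- The ring homomorphism taking a signal of one layer to its sub-messages with index in `S`. -/
def messageHom (S : Finset ι) : R →+* ∀ i : S, R ⧸ q i :=
  RingHom.pi fun i : S => ((Pi.evalRingHom (fun i => R ⧸ q i) i).comp
    (e.symm : R ⧸ J →+* ∀ i, R ⧸ q i)).comp (Ideal.Quotient.mk J)

theorem messageHom_apply (S : Finset ι) (x : R) (i : S) :
    messageHom e S x i = e.symm (Ideal.Quotient.mk J x) i := rfl

theorem messageHom_surjective (S : Finset ι) : Function.Surjective (messageHom e S) :=
  (Subtype.surjective_restrict (β := fun i => R ⧸ q i) (· ∈ S)).comp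
    (e.symm.surjective.comp Ideal.Quotient.mk_surjective)

theorem card_quotient_ker_messageHom (S : Finset ι) :
    Nat.card (R ⧸ RingHom.ker (messageHom e S)) = ∏ i ∈ S, Nat.card (R ⧸ q i) := by
  rw [Nat.card_congr
    (RingHom.quotientKerEquivOfSurjective (messageHom_surjective e S)).toEquiv, Nat.card_pi,
    Finset.prod_coe_sort S fun i => Nat.card (R ⧸ q i)]

end Messages

section Fields

theorem omega_primitive : IsPrimitiveRoot omega 3 := by
  simpa [omega] using Complex.isPrimitiveRoot_exp 3 (by norm_num)

theorem omega_quad : omega ^ 2 + omega + 1 = 0 := by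
  have h := omega_primitive.geom_sum_eq_zero (by norm_num)
  simp only [Finset.sum_range_succ, Finset.sum_range_zero] at h
  linear_combination h

theorem omega_conj : (starRingEnd ℂ) omega = -1 - omega := by
  rw [← Complex.inv_eq_conj (Complex.norm_eq_one_of_pow_eq_one omega_primitive.pow_eq_one
    three_ne_zero)]
  have h0 : omega ≠ 0 := omega_primitive.ne_zero three_ne_zero
  field_simp
  linear_combination omega_quad

theorem omega_conj_ne : (starRingEnd ℂ) omega ≠ omega := by
  intro h
  rw [omega_conj] at h
  have h3 : (3 : ℂ) = 0 := by linear_combination 4 * omega_quad + (2 * omega + 1) * h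
  exact three_ne_zero h3

instance : FiniteDimensional ℚ K := IntermediateField.adjoin.finiteDimensional omega_integral

instance : FiniteDimensional K L := IntermediateField.adjoin.finiteDimensional theta_integral

instance : FiniteDimensional ℚ L := FiniteDimensional.trans ℚ K L

instance : NumberField L where
  to_charZero := inferInstance
  to_finiteDimensional := inferInstance

theorem omega_minpoly : minpoly ℚ omega = Polynomial.X ^ 2 + Polynomial.X + 1 := by
  rw [← Polynomial.cyclotomic_eq_minpoly_rat omega_primitive (by norm_num),
    Polynomial.cyclotomic_three]

theorem finrank_rat_K : Module.finrank ℚ K = 2 := by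
  rw [IntermediateField.adjoin.finrank omega_integral, omega_minpoly]
  compute_degree!

theorem finrank_K_L : Module.finrank K L = 3 := by
  rw [IntermediateField.adjoin.finrank theta_integral, theta_minpoly, cubic_monic.natDegree_map,
    cubic_natDegree]

theorem finrank_rat_L : Module.finrank ℚ L = 6 := by
  rw [← Module.finrank_mul_finrank ℚ K L, finrank_rat_K, finrank_K_L]

theorem omegaL_quad : omegaL ^ 2 + omegaL + 1 = 0 := Subtype.ext omega_quad

theorem thetaL_root : thetaL ^ 3 + thetaL ^ 2 - 2 * thetaL - 1 = 0 := Subtype.ext theta_root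

theorem sigma_omegaL : sigma omegaL = omegaL := sigma.commutes _

theorem sigma_thetaL : sigma thetaL = thetaL ^ 2 - 2 := by
  apply Subtype.ext
  have hz : zeta ≠ 0 := zeta_primitive.ne_zero (by norm_num)
  have h : zeta ^ 2 + (zeta ^ 2)⁻¹ = theta ^ 2 - 2 := by
    rw [theta_eq]
    field_simp
    ring
  exact sigma_theta.trans h

theorem sigma_sigma_thetaL : sigma (sigma thetaL) = 1 - thetaL - thetaL ^ 2 := by
  simp only [sigma_thetaL, map_sub, map_pow, map_ofNat]
  linear_combination (thetaL - 1) * thetaL_root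

theorem sigma_thetaL_ne : sigma thetaL ≠ thetaL := by
  intro h
  have hroot := thetaL_root
  have hfactor : (thetaL - 2) * (thetaL + 1) = 0 := by linear_combination h - sigma_thetaL
  rcases mul_eq_zero.1 hfactor with h2 | h1
  · rw [sub_eq_zero.1 h2] at hroot
    norm_num at hroot
  · rw [eq_neg_of_add_eq_zero_left h1] at hroot
    norm_num at hroot

theorem sigma_cubed (x : L) : sigma (sigma (sigma x)) = x := by
  have hθ : sigma (sigma (sigma thetaL)) = thetaL := by
    rw [sigma_sigma_thetaL]
    simp only [sigma_thetaL, map_sub, map_pow, map_one]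
    linear_combination (1 - thetaL) * thetaL_root
  have h : (sigma.trans (sigma.trans sigma)).toAlgHom = AlgHom.id K L :=
    (IntermediateField.adjoin.powerBasis theta_integral).algHom_ext <| by
      rw [IntermediateField.adjoin.powerBasis_gen]
      exact hθ
  exact DFunLike.congr_fun h x

theorem orderOf_sigma : orderOf sigma = 3 :=
  orderOf_eq_prime (AlgEquiv.ext fun x => sigma_cubed x)
    fun h => sigma_thetaL_ne (DFunLike.congr_fun h thetaL)

end Fields

section Integers

/-- `ω` as an algebraic integer of `L`. -/
noncomputable def omegaO : 𝓞 L :=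
  ⟨omegaL, Polynomial.X ^ 2 + Polynomial.X + 1, by monicity!, by simpa using omegaL_quad⟩

/-- `θ` as an algebraic integer of `L`. -/
noncomputable def thetaO : 𝓞 L := ⟨thetaL, cubic, cubic_monic, by simpa [cubic] using thetaL_root⟩

/-- `α` as an algebraic integer of `L`. -/
noncomputable def alphaO : 𝓞 L := 1 + omegaO + thetaO

/-- The restriction of `σ` to the ring of integers of `L`. -/
noncomputable def sigmaO : 𝓞 L →+* 𝓞 L := NumberField.RingOfIntegers.mapRingHom sigma

theorem omegaO_quad : omegaO ^ 2 + omegaO + 1 = 0 :=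
  NumberField.RingOfIntegers.ext omegaL_quad

theorem thetaO_root : thetaO ^ 3 + thetaO ^ 2 - 2 * thetaO - 1 = 0 :=
  NumberField.RingOfIntegers.ext thetaL_root

theorem sigmaO_injective : Function.Injective sigmaO := fun _ _ h =>
  NumberField.RingOfIntegers.ext (sigma.injective (congrArg (algebraMap (𝓞 L) L) h))

theorem sigmaO_omegaO : sigmaO omegaO = omegaO := NumberField.RingOfIntegers.ext sigma_omegaL

theorem sigmaO_thetaO : sigmaO thetaO = thetaO ^ 2 - 2 :=
  NumberField.RingOfIntegers.ext sigma_thetaL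

theorem sigmaO_sigmaO_thetaO : sigmaO (sigmaO thetaO) = 1 - thetaO - thetaO ^ 2 :=
  NumberField.RingOfIntegers.ext sigma_sigma_thetaL

theorem sigmaO_cubed (b : 𝓞 L) : sigmaO (sigmaO (sigmaO b)) = b :=
  NumberField.RingOfIntegers.ext (sigma_cubed b)

theorem norm_K_eq_cyclicNorm (b : 𝓞 L) :
    algebraMap K ℂ (Algebra.norm K (b : L)) = algebraMap (𝓞 L) ℂ (cyclicNorm sigmaO b) := by
  have h := algebraMap_norm_eq_prod_range_pow (orderOf_sigma.trans finrank_K_L.symm) (b : L)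
  rw [finrank_K_L] at h
  simp only [Finset.prod_range_succ, Finset.prod_range_zero, one_mul] at h
  exact congrArg (algebraMap L ℂ) h

theorem absNorm_span_eq_normSq (b : 𝓞 L) : (Ideal.absNorm (Ideal.span {b}) : ℝ) =
    Complex.normSq (algebraMap (𝓞 L) ℂ (cyclicNorm sigmaO b)) := by
  have h := norm_eq_normSq_norm finrank_rat_K
    (IntermediateField.mem_adjoin_simple_self ℚ omega) omega_conj_ne (b : L)
  rw [← Algebra.coe_norm_int, Rat.cast_intCast] at h
  rw [← norm_K_eq_cyclicNorm, Ideal.absNorm_span_singleton, Nat.cast_natAbs, Int.cast_abs, h]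
  exact abs_of_nonneg (Complex.normSq_nonneg _)

theorem normSq_add_mul_omega (a b : ℝ) :
    Complex.normSq (a + b * omega) = a ^ 2 - a * b + b ^ 2 := by
  have h := Complex.mul_conj (a + b * omega)
  rw [map_add, map_mul, omega_conj, Complex.conj_ofReal, Complex.conj_ofReal] at h
  rw [← Complex.ofReal_inj, ← h]
  push_cast
  linear_combination (-b ^ 2 : ℂ) * omega_quad

theorem cyclicNorm_add_thetaO {c : 𝓞 L} (hc : sigmaO c = c) :
    cyclicNorm sigmaO (c + thetaO) = c ^ 3 - c ^ 2 - 2 * c + 1 := by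
  simp only [cyclicNorm, map_add, hc, sigmaO_sigmaO_thetaO]
  rw [sigmaO_thetaO]
  linear_combination (1 - thetaO ^ 2 - c * thetaO) * thetaO_root

theorem absNorm_span_add_thetaO {c : 𝓞 L} (hc : sigmaO c = c) {m n : ℤ}
    (h : c ^ 3 - c ^ 2 - 2 * c + 1 = m + n * omegaO) :
    (Ideal.absNorm (Ideal.span {c + thetaO}) : ℤ) = m ^ 2 - m * n + n ^ 2 := by
  have key := normSq_add_mul_omega m n
  have hω : algebraMap (𝓞 L) ℂ (m + n * omegaO) = (m : ℝ) + (n : ℝ) * omega := by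
    rw [map_add, map_mul, map_intCast, map_intCast]
    rfl
  rw [← hω, ← h, ← cyclicNorm_add_thetaO hc, ← absNorm_span_eq_normSq] at key
  exact_mod_cast key

theorem absNorm_span_alphaO : Ideal.absNorm (Ideal.span {alphaO}) = 7 := by
  have h := absNorm_span_add_thetaO (c := 1 + omegaO) (m := -2) (n := -3)
    (by rw [map_add, map_one, sigmaO_omegaO])
    (by push_cast; linear_combination (omegaO + 1) * omegaO_quad)
  exact Nat.cast_injective (R := ℤ) (h.trans (by norm_num))

theorem absNorm_span_neg_omegaO_add_thetaO :
    Ideal.absNorm (Ideal.span {-omegaO + thetaO}) = 7 := by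
  have h := absNorm_span_add_thetaO (c := -omegaO) (m := 1) (n := 3)
    (by rw [map_neg, sigmaO_omegaO])
    (by push_cast; linear_combination -omegaO * omegaO_quad)
  exact Nat.cast_injective (R := ℤ) (h.trans (by norm_num))

end Integers

section Discriminant

theorem trace_adjoinSimple_gen {F E : Type*} [Field F] [Field E] [Algebra F E] {x : E}
    (hx : IsIntegral F x) :
    Algebra.trace F _ (IntermediateField.AdjoinSimple.gen F x) = -(minpoly F x).nextCoeff := by
  have h := (IntermediateField.adjoin.powerBasis hx).trace_gen_eq_nextCoeff_minpoly
  rwa [IntermediateField.adjoin.powerBasis_gen, IntermediateField.minpoly_gen] at h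

theorem trace_thetaL : Algebra.trace K L thetaL = -1 := by
  have hcoeff : cubic.nextCoeff = 1 := by
    rw [Polynomial.nextCoeff_of_natDegree_pos (by simp [cubic_natDegree]), cubic_natDegree]
    simp [cubic, Polynomial.coeff_X, Polynomial.coeff_one]
  refine (trace_adjoinSimple_gen theta_integral).trans ?_
  rw [theta_minpoly, Polynomial.nextCoeff_map (algebraMap ℤ K).injective_int, hcoeff, map_one]

theorem trace_thetaL_sq : Algebra.trace K L (thetaL ^ 2) = 5 := by
  have h := Algebra.trace_eq_of_algEquiv sigma thetaL
  rw [sigma_thetaL, map_sub, trace_thetaL, ← map_ofNat (algebraMap K L),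
    Algebra.trace_algebraMap, finrank_K_L] at h
  norm_num at h
  linear_combination h

theorem trace_thetaL_pow_add_three (n : ℕ) : Algebra.trace K L (thetaL ^ (n + 3)) =
    -Algebra.trace K L (thetaL ^ (n + 2)) + 2 * Algebra.trace K L (thetaL ^ (n + 1))
      + Algebra.trace K L (thetaL ^ n) := by
  have h : thetaL ^ (n + 3) = -thetaL ^ (n + 2) + (2 : K) • thetaL ^ (n + 1) + thetaL ^ n := by
    rw [ofNat_smul_eq_nsmul, nsmul_eq_mul]
    push_cast
    linear_combination thetaL ^ n * thetaL_root
  rw [h, map_add, map_add, map_neg, map_smul, smul_eq_mul]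

theorem trace_thetaL_pow (j : Fin 5) : Algebra.trace K L (thetaL ^ (j : ℕ)) =
    algebraMap ℚ K ((![3, -1, 5, -4, 13] : Fin 5 → ℤ) j : ℚ) := by
  have h0 : Algebra.trace K L (thetaL ^ 0) = 3 := by
    rw [pow_zero, ← map_one (algebraMap K L), Algebra.trace_algebraMap, finrank_K_L]
    norm_num
  have h1 : Algebra.trace K L (thetaL ^ 1) = -1 := by rw [pow_one, trace_thetaL]
  have h3 : Algebra.trace K L (thetaL ^ 3) = -4 := by
    rw [trace_thetaL_pow_add_three 0, h0, h1, trace_thetaL_sq]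
    norm_num
  have h4 : Algebra.trace K L (thetaL ^ 4) = 13 := by
    rw [trace_thetaL_pow_add_three 1, h3, h1, trace_thetaL_sq]
    norm_num
  fin_cases j
  · simpa using h0
  · simpa using h1
  · simpa using trace_thetaL_sq
  · simpa using h3
  · simpa using h4

/-- `ω` as an element of `K`. -/
noncomputable def omegaK : K := ⟨omega, IntermediateField.mem_adjoin_simple_self ℚ omega⟩

theorem trace_omegaK : Algebra.trace ℚ K omegaK = -1 := by
  have hdeg : (Polynomial.X ^ 2 + Polynomial.X + 1 : Polynomial ℚ).natDegree = 2 := by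
    compute_degree!
  refine (trace_adjoinSimple_gen omega_integral).trans ?_
  rw [omega_minpoly, Polynomial.nextCoeff_of_natDegree_pos (by rw [hdeg]; norm_num), hdeg]
  simp [Polynomial.coeff_X, Polynomial.coeff_one]

theorem trace_omegaK_pow (i : Fin 3) :
    Algebra.trace ℚ K (omegaK ^ (i : ℕ)) = ((![2, -1, -1] : Fin 3 → ℤ) i : ℚ) := by
  have h0 : Algebra.trace ℚ K 1 = 2 := by
    rw [← map_one (algebraMap ℚ K), Algebra.trace_algebraMap, finrank_rat_K]
    norm_num
  have h2 : Algebra.trace ℚ K (omegaK ^ 2) = -1 := by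
    have hquad : omegaK ^ 2 = -omegaK - 1 := by
      have h : omegaK ^ 2 + omegaK + 1 = 0 := Subtype.ext omega_quad
      linear_combination h
    rw [hquad, map_sub, map_neg, trace_omegaK, h0]
    norm_num
  fin_cases i
  · simpa using h0
  · simpa using trace_omegaK
  · simpa using h2

/-- The integers `ω ^ i θ ^ j` of `L`. -/
noncomputable def powerFamily (a : Fin 2 × Fin 3) : 𝓞 L := omegaO ^ (a.1 : ℕ) * thetaO ^ (a.2 : ℕ)

theorem trace_omegaO_pow_mul_thetaO_pow (i : Fin 3) (j : Fin 5) :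
    Algebra.trace ℤ (𝓞 L) (omegaO ^ (i : ℕ) * thetaO ^ (j : ℕ)) =
      (![2, -1, -1] : Fin 3 → ℤ) i * (![3, -1, 5, -4, 13] : Fin 5 → ℤ) j := by
  have h := trace_algebraMap_mul (k := ℚ) (omegaK ^ (i : ℕ)) (trace_thetaL_pow j)
  rw [trace_omegaK_pow, map_pow] at h
  rw [← Int.cast_inj (α := ℚ), Algebra.coe_trace_int, Int.cast_mul, ← h]
  rfl

theorem traceMatrix_powerFamily : Algebra.traceMatrix ℤ powerFamily =
    Matrix.kroneckerMap (· * ·) !![2, -1; -1, -1] !![3, -1, 5; -1, 5, -4; 5, -4, 13] := by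
  ext ⟨i, j⟩ ⟨i', j'⟩
  have hmul : powerFamily (i, j) * powerFamily (i', j') =
      omegaO ^ (i + i' : ℕ) * thetaO ^ (j + j' : ℕ) := by
    simp only [powerFamily]
    ring
  rw [Algebra.traceMatrix_apply, Algebra.traceForm_apply, Matrix.kroneckerMap_apply, hmul,
    trace_omegaO_pow_mul_thetaO_pow ⟨i + i', by omega⟩ ⟨j + j', by omega⟩]
  congr 1
  · fin_cases i <;> fin_cases i' <;> rfl
  · fin_cases j <;> fin_cases j' <;> rfl

theorem discr_powerFamily : Algebra.discr ℤ powerFamily = -64827 := by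
  rw [Algebra.discr_def, traceMatrix_powerFamily, Matrix.det_kronecker, Matrix.det_fin_two,
    Matrix.det_fin_three]
  simp

theorem abs_discr_le : |NumberField.discr L| ≤ 64827 := by
  have h : NumberField.discr L ∣ -64827 := by
    rw [← discr_powerFamily]
    exact discr_dvd_algebraDiscr (by simp [finrank_rat_L]) powerFamily
  exact Int.le_of_dvd (by norm_num) ((abs_dvd _ _).2 (dvd_neg.1 h))

theorem minkowski_bound_lt :
    (4 / Real.pi) ^ NumberField.InfinitePlace.nrComplexPlaces L *
      ((Module.finrank ℚ L).factorial / Module.finrank ℚ L ^ Module.finrank ℚ L *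
        √|(NumberField.discr L : ℝ)|) < 9 := by
  have hr : NumberField.InfinitePlace.nrComplexPlaces L ≤ 3 := by
    have h := NumberField.InfinitePlace.card_add_two_mul_card_eq_rank L
    rw [finrank_rat_L] at h
    omega
  have hpi : (4 / Real.pi) ^ NumberField.InfinitePlace.nrComplexPlaces L ≤ 2.1 := by
    calc (4 / Real.pi) ^ NumberField.InfinitePlace.nrComplexPlaces L
        ≤ (4 / Real.pi) ^ 3 := by
          refine pow_le_pow_right₀ ?_ hr
          rw [one_le_div Real.pi_pos]
          exact Real.pi_le_four
      _ ≤ (4 / 3.14) ^ 3 := by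
          have := Real.pi_gt_d2
          gcongr
      _ ≤ 2.1 := by norm_num
  have hdiscr : √|(NumberField.discr L : ℝ)| ≤ 255 := by
    refine Real.sqrt_le_iff.2 ⟨by norm_num, ?_⟩
    have h : ((|NumberField.discr L| : ℤ) : ℝ) ≤ (64827 : ℤ) := by exact_mod_cast abs_discr_le
    push_cast at h
    linarith
  have hfact : ((Nat.factorial 6 : ℝ) / (6 : ℕ) ^ 6) = 5 / 324 := by norm_num [Nat.factorial]
  rw [finrank_rat_L, hfact]
  calc _ ≤ 2.1 * (5 / 324 * 255 : ℝ) := by gcongr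
    _ < 9 := by norm_num

end Discriminant

section PrincipalIdeals

theorem ringHom_thetaO (f : 𝓞 L →+* ZMod 7) : f thetaO = 2 := by
  have hroot : ∀ t : ZMod 7, t ^ 3 + t ^ 2 - 2 * t - 1 = 0 → t = 2 := by decide
  refine hroot _ ?_
  simpa only [map_add, map_sub, map_mul, map_pow, map_one, map_ofNat, map_zero] using
    congrArg f thetaO_root

theorem ringHom_omegaO (f : 𝓞 L →+* ZMod 7) : f omegaO = 2 ∨ f omegaO = 4 := by
  have hroot : ∀ w : ZMod 7, w ^ 2 + w + 1 = 0 → w = 2 ∨ w = 4 := by decide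
  refine hroot _ ?_
  simpa only [map_add, map_pow, map_one, map_zero] using congrArg f omegaO_quad

theorem isPrincipal_of_absNorm_eq_seven {P : Ideal (𝓞 L)} (h : Ideal.absNorm P = 7) :
    P.IsPrincipal := by
  have : Fact (Nat.Prime 7) := ⟨by norm_num⟩
  obtain ⟨f, hf⟩ := exists_ringHom_zmod_ker_eq (p := 7) (by norm_num) h
  have hP (a : 𝓞 L) (ha : f a = 0) (ha7 : Ideal.absNorm (Ideal.span {a}) = 7) : P.IsPrincipal :=
    ⟨a, eq_span_singleton_of_mem (hf ▸ RingHom.ker_ne_top f) (hf ▸ ha) (by norm_num [ha7])⟩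
  have hθ := ringHom_thetaO f
  rcases ringHom_omegaO f with hω | hω
  · refine hP (-omegaO + thetaO) ?_ absNorm_span_neg_omegaO_add_thetaO
    rw [map_add, map_neg, hω, hθ, neg_add_cancel]
  · refine hP alphaO ?_ absNorm_span_alphaO
    rw [alphaO, map_add, map_add, map_one, hω, hθ]
    rfl

theorem card_eq_seven {F : Type*} [Field F] [Fintype F] {w t : F} (hw : w ^ 2 + w + 1 = 0)
    (ht : t ^ 3 + t ^ 2 - 2 * t - 1 = 0) (h9 : Fintype.card F < 9) : Fintype.card F = 7 := by
  have h3 := card_mod_three_ne_two hw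
  have h7 := card_mod_seven ht
  have h1 : 1 < Fintype.card F := Fintype.one_lt_card
  have hpp := FiniteField.isPrimePow_card F
  have h6 : ¬ IsPrimePow 6 := by decide
  unfold Nat.ModEq at h7
  have : Fintype.card F ≠ 6 := fun h => h6 (h ▸ hpp)
  omega

theorem absNorm_eq_seven_of_isPrime {P : Ideal (𝓞 L)} [hP : P.IsPrime] (h0 : P ≠ ⊥)
    (h9 : Ideal.absNorm P < 9) : Ideal.absNorm P = 7 := by
  have := hP.isMaximal h0
  have := Ideal.finiteQuotientOfFreeOfNeBot P h0
  have := Fintype.ofFinite (𝓞 L ⧸ P)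
  let _ := Ideal.Quotient.field P
  have hcard : Ideal.absNorm P = Fintype.card (𝓞 L ⧸ P) :=
    (Submodule.cardQuot_apply P).trans Nat.card_eq_fintype_card
  have hω := congrArg (Ideal.Quotient.mk P) omegaO_quad
  have hθ := congrArg (Ideal.Quotient.mk P) thetaO_root
  simp only [map_add, map_sub, map_mul, map_pow, map_one, map_ofNat, map_zero] at hω hθ
  rw [hcard] at h9 ⊢
  exact card_eq_seven hω hθ h9

instance : IsPrincipalIdealRing (𝓞 L) := by
  refine RingOfIntegers.isPrincipalIdealRing_of_isPrincipal_of_norm_le_of_isPrime fun P hP hle => ?_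
  have h9 : Ideal.absNorm (P : Ideal (𝓞 L)) < 9 := by
    exact_mod_cast hle.trans_lt minkowski_bound_lt
  exact isPrincipal_of_absNorm_eq_seven
    (absNorm_eq_seven_of_isPrime (nonZeroDivisors.coe_ne_zero P) h9)

end PrincipalIdeals

section ReducedNorm

theorem exists_residueHom : ∃ f : 𝓞 L →+* ZMod 7,
    RingHom.ker f = Ideal.span {alphaO} ∧ f omegaO = 4 ∧ ∀ b, f (sigmaO b) = f b := by
  obtain ⟨f, hf⟩ := exists_ringHom_zmod_ker_eq (p := 7) (by norm_num) absNorm_span_alphaO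
  have hθ := ringHom_thetaO f
  have hω : f omegaO = 4 := by
    have hα : f (1 + omegaO + thetaO) = 0 := by
      rw [← RingHom.mem_ker, hf]
      exact Ideal.mem_span_singleton_self _
    rw [map_add, map_add, map_one, hθ] at hα
    exact (by decide : ∀ w : ZMod 7, 1 + w + 2 = 0 → w = 4) _ hα
  have : Fact (Nat.Prime 7) := ⟨by norm_num⟩
  have hfσ : f = f.comp sigmaO := by
    refine ringHom_zmod_eq_of_ker_le ?_
    rw [hf, Ideal.span_singleton_le_iff_mem, RingHom.mem_ker, RingHom.comp_apply, alphaO]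
    simp only [map_add, map_sub, map_pow, map_one, map_ofNat, sigmaO_omegaO, sigmaO_thetaO, hω, hθ]
    rfl
  exact ⟨f, hf, hω, fun b => (RingHom.congr_fun hfσ b).symm⟩

theorem reducedNorm_id_zmod_seven_anisotropic (y : Fin 3 → ZMod 7)
    (hy : reducedNorm (RingHom.id (ZMod 7)) 4 y = 0) : y = 0 := by
  have key : ∀ a b c : ZMod 7, a * a * a + 4 * (b * b * b) + 4 ^ 2 * (c * c * c)
      - 4 * (a * b * c + b * c * a + c * a * b) = 0 → a = 0 ∧ b = 0 ∧ c = 0 := by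
    decide
  rw [reducedNorm_eq] at hy
  obtain ⟨h0, h1, h2⟩ := key _ _ _ hy
  ext1 l
  fin_cases l <;> assumption

theorem reducedNorm_sigmaO_ne_zero {x : Fin 3 → 𝓞 L} (hx : x ≠ 0) :
    reducedNorm sigmaO omegaO x ≠ 0 := by
  obtain ⟨f, hf, hω, hfσ⟩ := exists_residueHom
  have hα0 : alphaO ≠ 0 := by
    intro h
    simpa [h] using absNorm_span_alphaO
  have hαu : ¬ IsUnit alphaO := by
    intro h
    simpa [Ideal.span_singleton_eq_top.2 h] using absNorm_span_alphaO
  refine reducedNorm_ne_zero sigmaO_injective hα0 (fun y hy => ?_) hαu hx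
  exact dvd_of_reducedNorm_eq_zero hf hfσ (hω ▸ reducedNorm_id_zmod_seven_anisotropic) hy

theorem one_le_normSq_of_sigmaO_fixed {b : 𝓞 L} (hb : b ≠ 0) (hσ : sigmaO b = b) :
    1 ≤ Complex.normSq (algebraMap (𝓞 L) ℂ b) := by
  have h : (1 : ℝ) ≤ Ideal.absNorm (Ideal.span {b}) := by
    rw [Nat.one_le_cast, Nat.one_le_iff_ne_zero, Ne, Ideal.absNorm_eq_zero_iff,
      Ideal.span_singleton_eq_bot]
    exact hb
  have hcube : cyclicNorm sigmaO b = b ^ 3 := by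
    rw [cyclicNorm, hσ, hσ]
    ring
  rw [absNorm_span_eq_normSq, hcube, map_pow, map_pow] at h
  exact (one_le_pow_iff_of_nonneg (Complex.normSq_nonneg _) three_ne_zero).1 h

theorem one_le_normSq_reducedNorm {x : Fin 3 → 𝓞 L} (hx : x ≠ 0) :
    1 ≤ Complex.normSq (algebraMap (𝓞 L) ℂ (reducedNorm sigmaO omegaO x)) :=
  one_le_normSq_of_sigmaO_fixed (reducedNorm_sigmaO_ne_zero hx)
    (reducedNorm_fixed sigmaO_cubed sigmaO_omegaO x)

theorem isLeast_normSq_reducedNorm {I : Ideal (𝓞 L)} (hI : I ≠ ⊥) :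
    IsLeast {r | ∃ x : Fin 3 → 𝓞 L, x ≠ 0 ∧ (∀ l, x l ∈ I) ∧
      Complex.normSq (algebraMap (𝓞 L) ℂ (reducedNorm sigmaO omegaO x)) = r}
      (Ideal.absNorm I) := by
  obtain ⟨b, rfl⟩ := IsPrincipalIdealRing.principal I
  have hb : b ≠ 0 := by simpa using hI
  constructor
  · refine ⟨Pi.single 0 b, by simpa using hb, fun l => ?_, ?_⟩
    · obtain rfl | hl := eq_or_ne l 0
      · simp
      · simp [hl]
    · rw [reducedNorm_single_zero, ← absNorm_span_eq_normSq]
  · rintro _ ⟨x, hx0, hx, rfl⟩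
    choose y hy using fun l => Ideal.mem_span_singleton.1 (hx l)
    obtain rfl : x = b • y := funext hy
    have hy0 : y ≠ 0 := by
      rintro rfl
      simp at hx0
    rw [reducedNorm_smul, map_mul, map_mul, ← absNorm_span_eq_normSq]
    exact le_mul_of_one_le_right (Nat.cast_nonneg _) (one_le_normSq_reducedNorm hy0)

end ReducedNorm

section Codewords

theorem codeword_eq (x : Fin 3 → 𝓞 L) :
    codeword x = (cyclicMatrix sigmaO omegaO (alphaO • x)).map (algebraMap (𝓞 L) ℂ) := by
  rw [codeword, cyclicMatrix_smul, Matrix.map_mul, Matrix.diagonal_map (map_zero _)]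
  congr 1
  · congr 1
    ext i
    fin_cases i <;> rfl
  · ext i j
    fin_cases i <;> fin_cases j <;> rfl

theorem codeword_sub (x y : Fin 3 → 𝓞 L) : codeword x - codeword y = codeword (x - y) := by
  rw [codeword_eq, codeword_eq, codeword_eq, smul_sub, cyclicMatrix_sub,
    Matrix.map_sub _ (map_sub _)]

theorem det_codeword_mul_conjTranspose (x : Fin 3 → 𝓞 L) :
    (codeword x * (codeword x)ᴴ).det = ((7 * Complex.normSq
      (algebraMap (𝓞 L) ℂ (reducedNorm sigmaO omegaO x)) : ℝ) : ℂ) := by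
  have hα : Complex.normSq (algebraMap (𝓞 L) ℂ (cyclicNorm sigmaO alphaO)) = 7 := by
    rw [← absNorm_span_eq_normSq, absNorm_span_alphaO, Nat.cast_ofNat]
  have hdet : (codeword x).det =
      algebraMap (𝓞 L) ℂ (cyclicNorm sigmaO alphaO * reducedNorm sigmaO omegaO x) := by
    rw [codeword_eq, ← RingHom.mapMatrix_apply, ← RingHom.map_det, ← reducedNorm_smul, reducedNorm]
  rw [det_mul_conjTranspose_self, hdet, map_mul, map_mul, hα]

theorem codeword_injective : Function.Injective codeword := by
  intro x y h
  by_contra hne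
  have hpos := one_le_normSq_reducedNorm (sub_ne_zero.2 hne)
  have hdet := det_codeword_mul_conjTranspose (x - y)
  rw [← codeword_sub, h, sub_self, zero_mul, Matrix.det_zero, eq_comm,
    Complex.ofReal_eq_zero] at hdet
  linarith

theorem pairDets_image_codeword (I : Ideal (𝓞 L)) (c : Fin 3 → 𝓞 L) :
    pairDets (codeword '' {x | ∀ l, x l - c l ∈ I}) = (7 * ·) '' {r | ∃ x : Fin 3 → 𝓞 L,
      x ≠ 0 ∧ (∀ l, x l ∈ I) ∧
        Complex.normSq (algebraMap (𝓞 L) ℂ (reducedNorm sigmaO omegaO x)) = r} := by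
  ext d
  constructor
  · rintro ⟨_, ⟨x, hx, rfl⟩, _, ⟨y, hy, rfl⟩, hne, hd⟩
    rw [codeword_sub, det_codeword_mul_conjTranspose, Complex.ofReal_inj] at hd
    refine ⟨_, ⟨x - y, sub_ne_zero.2 (ne_of_apply_ne codeword hne), fun l => ?_, rfl⟩, hd.symm⟩
    simpa only [Pi.sub_apply, sub_sub_sub_cancel_right] using Ideal.sub_mem _ (hx l) (hy l)
  · rintro ⟨_, ⟨x, hx0, hx, rfl⟩, rfl⟩
    refine ⟨_, ⟨c + x, fun l => ?_, rfl⟩, _, ⟨c, fun l => ?_, rfl⟩, codeword_injective.ne ?_, ?_⟩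
    · simpa only [Pi.add_apply, add_sub_cancel_left] using hx l
    · simp only [sub_self, zero_mem]
    · simpa only [ne_eq, add_eq_left] using hx0
    · rw [codeword_sub, add_sub_cancel_left, det_codeword_mul_conjTranspose]

theorem isLeast_pairDets_image_codeword {I : Ideal (𝓞 L)} (hI : I ≠ ⊥) (c : Fin 3 → 𝓞 L) :
    IsLeast (pairDets (codeword '' {x | ∀ l, x l - c l ∈ I})) (7 * Ideal.absNorm I) := by
  rw [pairDets_image_codeword]
  exact (monotone_mul_left_of_nonneg (by norm_num)).map_isLeast (isLeast_normSq_reducedNorm hI)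

end Codewords

section Scheme

variable {k : ℕ} {q : Fin k → Ideal (𝓞 L)} (e : (∀ i, 𝓞 L ⧸ q i) ≃+* 𝓞 L ⧸ ∏ i, q i)
  (S : Finset (Fin k)) (v : ∀ i, Message q i)

theorem exists_latticeSubcode_eq : ∃ c : Fin 3 → 𝓞 L, latticeSubcode q e S v =
    codeword '' {x | ∀ l, x l - c l ∈ RingHom.ker (messageHom e S)} := by
  choose c hc using fun l => Ideal.Quotient.mk_surjective (e fun i => v i l)
  refine ⟨c, Set.ext fun X => exists_congr fun x => and_congr ?_ eq_comm⟩
  simp only [Set.mem_ofPred_eq, RingHom.mem_ker, map_sub, sub_eq_zero, funext_iff,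
    messageHom_apply, hc, RingEquiv.symm_apply_apply, Subtype.forall]
  exact ⟨fun h l i hi => h i hi l, fun h i hi l => h l i hi⟩

theorem absNorm_ker_messageHom :
    Ideal.absNorm (RingHom.ker (messageHom e S)) = ∏ i ∈ S, Ideal.absNorm (q i) :=
  card_quotient_ker_messageHom e S

section Encoder

variable {e S v} {lead : 𝓞 L ⧸ ∏ i, q i → 𝓞 L}
  (hlead : ∀ c, Ideal.Quotient.mk (∏ i, q i) (lead c) = c)
include hlead

theorem encode_injective : Function.Injective (encode q e lead) := by
  intro w w' h
  funext i l
  have hl := congrArg (Ideal.Quotient.mk (∏ i, q i)) (congrFun (codeword_injective h) l)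
  rw [hlead, hlead] at hl
  exact congrFun (e.injective hl) i

theorem subcode_subset_latticeSubcode : subcode q e lead S v ⊆ latticeSubcode q e S v := by
  rintro _ ⟨d, hd, rfl⟩
  refine ⟨_, fun i hi l => ?_, rfl⟩
  rw [hlead, RingEquiv.symm_apply_apply, hd i hi]

end Encoder

variable (hq0 : ∀ i, q i ≠ ⊥)
include hq0

theorem isLeast_pairDets_latticeSubcode :
    IsLeast (pairDets (latticeSubcode q e S v)) (7 * (∏ i ∈ S, Ideal.absNorm (q i) : ℕ)) := by
  obtain ⟨c, hc⟩ := exists_latticeSubcode_eq e S v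
  have hker : RingHom.ker (messageHom e S) ≠ ⊥ := by
    rw [Ne, ← Ideal.absNorm_eq_zero_iff, absNorm_ker_messageHom, Finset.prod_eq_zero_iff]
    rintro ⟨i, _, hi⟩
    exact hq0 i (Ideal.absNorm_eq_zero_iff.1 hi)
  rw [hc, ← absNorm_ker_messageHom e S]
  exact isLeast_pairDets_image_codeword hker c

theorem minDet_latticeSubcode :
    minDet (latticeSubcode q e S v) = 7 * (∏ i ∈ S, Ideal.absNorm (q i) : ℕ) :=
  (isLeast_pairDets_latticeSubcode e S v hq0).csInf_eq

theorem isLeast_minDet_latticeSubcode :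
    IsLeast (pairDets (latticeSubcode q e S v)) (minDet (latticeSubcode q e S v)) := by
  rw [minDet_latticeSubcode e S v hq0]
  exact isLeast_pairDets_latticeSubcode e S v hq0

theorem minDet_latticeSubcode_empty : minDet (latticeSubcode q e ∅ v) = 7 := by
  rw [minDet_latticeSubcode e ∅ v hq0, Finset.prod_empty, Nat.cast_one, mul_one]

theorem rate_eq : rate q S = Real.logb 2 (∏ i ∈ S, Ideal.absNorm (q i) : ℕ) / 6 := by
  have hcard (i : Fin k) : Nat.card (Message q i) = Ideal.absNorm (q i) ^ 3 := by
    rw [Message, Nat.card_fun, Nat.card_fin]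
    rfl
  rw [rate, Nat.cast_prod, Real.logb_prod _ _ fun i _ =>
    Nat.cast_ne_zero.2 (mt Ideal.absNorm_eq_zero_iff.1 (hq0 i)), Finset.sum_div]
  refine Finset.sum_congr rfl fun i _ => ?_
  rw [hcard, Nat.cast_pow, Real.logb_pow, Nat.cast_ofNat]
  ring

variable {S} (hS : ∃ s ∈ S, q s ≠ ⊤)
include hS

theorem one_lt_prod_absNorm : 1 < ∏ i ∈ S, Ideal.absNorm (q i) := by
  have hpos (i : Fin k) : 1 ≤ Ideal.absNorm (q i) :=
    Nat.one_le_iff_ne_zero.2 (mt Ideal.absNorm_eq_zero_iff.1 (hq0 i))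
  obtain ⟨s, hs, hst⟩ := hS
  have hs1 : 1 < Ideal.absNorm (q s) := (hpos s).lt_of_ne' (mt Ideal.absNorm_eq_one_iff.1 hst)
  exact hs1.trans_le (Finset.single_le_prod' (fun i _ => hpos i) hs)

theorem rate_pos : 0 < rate q S := by
  rw [rate_eq S hq0]
  exact div_pos (Real.logb_pos one_lt_two (Nat.one_lt_cast.2 (one_lt_prod_absNorm hq0 hS)))
    (by norm_num)

theorem gain_latticeSubcode :
    gain (latticeSubcode q e ∅ v) (latticeSubcode q e S v) (rate q S) = 20 * Real.logb 10 2 := by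
  have hratio : minDet (latticeSubcode q e S v) / minDet (latticeSubcode q e ∅ v) =
      (∏ i ∈ S, Ideal.absNorm (q i) : ℕ) := by
    rw [minDet_latticeSubcode_empty e v hq0, minDet_latticeSubcode e S v hq0,
      mul_div_cancel_left₀ _ (by norm_num)]
  have hrate : Real.logb 10 2 * (6 * rate q S) =
      Real.logb 10 (∏ i ∈ S, Ideal.absNorm (q i) : ℕ) := by
    rw [rate_eq S hq0, mul_div_cancel₀ _ (by norm_num),
      Real.mul_logb two_ne_zero (by norm_num) (by norm_num)]
  have hR := rate_pos hq0 hS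
  rw [gain, hratio, ← hrate, div_eq_iff (by positivity)]
  ring

end Scheme

end PerfectCode

theorem mainTheorem4 (k : ℕ) (q : Fin k → Ideal (𝓞 PerfectCode.L))
    (hq0 : ∀ i, q i ≠ ⊥) (hq : Pairwise fun i j => IsCoprime (q i) (q j))
    (e : (∀ i, 𝓞 PerfectCode.L ⧸ q i) ≃+* 𝓞 PerfectCode.L ⧸ ∏ i, q i)
    (lead : 𝓞 PerfectCode.L ⧸ ∏ i, q i → 𝓞 PerfectCode.L)
    (hlead : ∀ c, Ideal.Quotient.mk (∏ i, q i) (lead c) = c)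
    (S : Finset (Fin k)) (hS : ∃ s ∈ S, q s ≠ ⊤)
    (v : ∀ i, PerfectCode.Message q i) :
    Function.Injective (PerfectCode.encode q e lead) ∧
    PerfectCode.subcode q e lead ∅ v ⊆ PerfectCode.latticeSubcode q e ∅ v ∧
    PerfectCode.subcode q e lead S v ⊆ PerfectCode.latticeSubcode q e S v ∧
    IsLeast (PerfectCode.pairDets (PerfectCode.latticeSubcode q e ∅ v))
      (PerfectCode.minDet (PerfectCode.latticeSubcode q e ∅ v)) ∧
    IsLeast (PerfectCode.pairDets (PerfectCode.latticeSubcode q e S v))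
      (PerfectCode.minDet (PerfectCode.latticeSubcode q e S v)) ∧
    0 < PerfectCode.minDet (PerfectCode.latticeSubcode q e ∅ v) ∧
    0 < PerfectCode.rate q S ∧
    PerfectCode.gain (PerfectCode.latticeSubcode q e ∅ v)
      (PerfectCode.latticeSubcode q e S v) (PerfectCode.rate q S) = 20 * Real.logb 10 2 ∧
    (PerfectCode.minDet (PerfectCode.subcode q e lead ∅ v) =
        PerfectCode.minDet (PerfectCode.latticeSubcode q e ∅ v) →
      PerfectCode.minDet (PerfectCode.subcode q e lead S v) =
        PerfectCode.minDet (PerfectCode.latticeSubcode q e S v) →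
      PerfectCode.gain (PerfectCode.subcode q e lead ∅ v) (PerfectCode.subcode q e lead S v)
        (PerfectCode.rate q S) = 20 * Real.logb 10 2) := by
  refine ⟨PerfectCode.encode_injective hlead, PerfectCode.subcode_subset_latticeSubcode hlead,
    PerfectCode.subcode_subset_latticeSubcode hlead,
    PerfectCode.isLeast_minDet_latticeSubcode e ∅ v hq0,
    PerfectCode.isLeast_minDet_latticeSubcode e S v hq0, ?_, PerfectCode.rate_pos hq0 hS,
    PerfectCode.gain_latticeSubcode e v hq0 hS, fun h h' => ?_⟩
  · rw [PerfectCode.minDet_latticeSubcode_empty e v hq0]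
    norm_num
  · rw [PerfectCode.gain, h, h']
    exact PerfectCode.gain_latticeSubcode e v hq0 hS
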